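/- Let $n\ge 1$ and let $M_n$ be the space of complex $n\times n$ matrices. For $X\in M_n$ put $|X|=(X^*X)^{1/2}$, let $|X|^p$ be defined by the functional calculus, and let $X\le Y$ mean that $Y-X$ is positive semidefinite (the Loewner order). (1) Let $A,B,C\in M_n$ and $p\ge 2$. Then there exist unitaries $U_1,U_2,U_3\in M_n$ such that $$U_1|A+B|^pU_1^*+U_2|B+C|^pU_2^*+U_3|C+A|^pU_3^*\le 2^{p-2}\bigl(|A+B+C|^p+|A|^p+|B|^p+|C|^p\bigr).$$ (2) Let $A,B,C\in M_n$ and $0<p\le 2$. Then there exist unitaries $U_1,U_2,U_3\in M_n$ such that $$U_1|A+B|^pU_1^*+U_2|B+C|^pU_2^*+U_3|C+A|^pU_3^*\ge 2^{p-2}\bigl(|A+B+C|^p+|A|^p+|B|^p+|C|^p\bigr).$$ (3) The constant $2^{p-2}$ is optimal: for each $n\ge1$ and each $p\ge2$, if (1) holds for all $A,B,C\in M_n$ with $2^{p-2}$ replaced by a real number $c$, then $c\ge 2^{p-2}$; for each $n\ge1$ and each $0<p\le2$, if (2) holds for all $A,B,C\in M_n$ with $2^{p-2}$ replaced by a real number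 $c$, then $c\le 2^{p-2}$. Moreover, for every $p>0$, equality holds by taking $A=B=-C\neq0$: in this case the right-hand side is nonzero, there are unitaries for which the two sides are equal, and any unitaries $U_1,U_2,U_3$ for which the inequality in (1) or the inequality in (2) holds give equality. -/

import Mathlib

open scoped ComplexOrder MatrixOrder Matrix

/-- The matrix `|X|ᵖ`, where `|X| = (X⋆ X)^{1/2}` and the real power of the positive semidefinite
matrix `|X|` is taken in the functional calculus. -/
noncomputable def absPow {n : ℕ} (X : Matrix (Fin n) (Fin n) ℂ) (p : ℝ) :
    Matrix (Fin n) (Fin n) ℂ :=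
  CFC.abs X ^ p

/-- The sum `U₁ |A+B|ᵖ U₁⋆ + U₂ |B+C|ᵖ U₂⋆ + U₃ |C+A|ᵖ U₃⋆` for unitary matrices `U₁, U₂, U₃`. -/
noncomputable def pairOrbitSum {n : ℕ} (p : ℝ) (A B C : Matrix (Fin n) (Fin n) ℂ)
    (U₁ U₂ U₃ : Matrix.unitaryGroup (Fin n) ℂ) : Matrix (Fin n) (Fin n) ℂ :=
  (U₁ : Matrix (Fin n) (Fin n) ℂ) * absPow (A + B) p * (U₁ : Matrix (Fin n) (Fin n) ℂ)ᴴ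
    + (U₂ : Matrix (Fin n) (Fin n) ℂ) * absPow (B + C) p * (U₂ : Matrix (Fin n) (Fin n) ℂ)ᴴ
    + (U₃ : Matrix (Fin n) (Fin n) ℂ) * absPow (C + A) p * (U₃ : Matrix (Fin n) (Fin n) ℂ)ᴴ

/-- The sum `|A+B+C|ᵖ + |A|ᵖ + |B|ᵖ + |C|ᵖ`. -/
noncomputable def eulerSum {n : ℕ} (p : ℝ) (A B C : Matrix (Fin n) (Fin n) ℂ) :
    Matrix (Fin n) (Fin n) ℂ :=
  absPow (A + B + C) p + absPow A p + absPow B p + absPow C p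

open scoped ComplexOrder MatrixOrder Matrix

/-! Euler's identity says that the three matrices |A+B|², |B+C|², |C+A|² and the four matrices
|A+B+C|², |A|², |B|², |C|² have the same sum S. With q = p/2 everything reduces to comparing S ^ q
with sums of q-th powers of positive semidefinite summands. For q ≥ 1, S ^ q lies above a sum of
unitary conjugates of the three q-th powers, and below a unitary conjugate of 4 ^ (q - 1) times the
sum of the four. For q ≤ 1 both bounds reverse, the second by operator concavity and with no
unitary. The bounds over the three terms split S ^ q as the sum of S ^ ((q-1)/2) * R * S ^ ((q-1)/2)
over the summands R. Each piece has the form Kᴴ * K, hence is unitarily equivalent to K * Kᴴ = R ^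
(1/2) * S ^ (q-1) * R ^ (1/2), which is compared with R ^ q using R ≤ S: by Löwner–Heinz for 1 ≤ q ≤
2, by min-max and Jensen for q ≥ 2, by a contraction argument for q ≤ 1. -/

namespace MatrixOrbit

variable {n : ℕ}

/-! ### Operator monotonicity and concavity of powers -/

section OperatorMonotone

open scoped Matrix.Norms.L2Operator

/-- The Löwner–Heinz inequality for matrices. -/
theorem rpow_le_rpow {A B : Matrix (Fin n) (Fin n) ℂ} {r : ℝ} (hr : r ∈ Set.Icc (0 : ℝ) 1)
    (h : A ≤ B) : A ^ r ≤ B ^ r :=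
  CFC.rpow_le_rpow hr h

theorem concaveOn_rpow {r : ℝ} (hr : r ∈ Set.Icc (0 : ℝ) 1) :
    ConcaveOn ℝ (Set.Ici (0 : Matrix (Fin n) (Fin n) ℂ)) (fun A => A ^ r) :=
  CFC.concaveOn_rpow hr

end OperatorMonotone

/-! ### Functional calculus in an eigenbasis -/

/-- The Hermitian matrix with orthonormal eigenbasis the columns of `U` and eigenvalues `d`. -/
noncomputable def unitaryDiag (U : Matrix.unitaryGroup (Fin n) ℂ) (d : Fin n → ℝ) :
    Matrix (Fin n) (Fin n) ℂ :=
  (U : Matrix (Fin n) (Fin n) ℂ) * Matrix.diagonal (fun i => (d i : ℂ)) *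
    (U : Matrix (Fin n) (Fin n) ℂ)ᴴ

theorem unitary_conjTranspose_mul_self (U : Matrix.unitaryGroup (Fin n) ℂ) :
    (U : Matrix (Fin n) (Fin n) ℂ)ᴴ * (U : Matrix (Fin n) (Fin n) ℂ) = 1 :=
  Unitary.coe_star_mul_self U

theorem unitary_mul_conjTranspose_self (U : Matrix.unitaryGroup (Fin n) ℂ) :
    (U : Matrix (Fin n) (Fin n) ℂ) * (U : Matrix (Fin n) (Fin n) ℂ)ᴴ = 1 :=
  Unitary.coe_mul_star_self U

theorem unitaryDiag_mul (U : Matrix.unitaryGroup (Fin n) ℂ) (d e : Fin n → ℝ) :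
    unitaryDiag U d * unitaryDiag U e = unitaryDiag U (fun i => d i * e i) := by
  unfold unitaryDiag
  calc _ = (U : Matrix (Fin n) (Fin n) ℂ) * Matrix.diagonal (fun i => (d i : ℂ)) *
        ((U : Matrix (Fin n) (Fin n) ℂ)ᴴ * (U : Matrix (Fin n) (Fin n) ℂ)) *
        Matrix.diagonal (fun i => (e i : ℂ)) * (U : Matrix (Fin n) (Fin n) ℂ)ᴴ := by
        simp only [mul_assoc]
    _ = _ := by
        rw [unitary_conjTranspose_mul_self, mul_one,
          mul_assoc (U : Matrix (Fin n) (Fin n) ℂ) (Matrix.diagonal _) (Matrix.diagonal _),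
          Matrix.diagonal_mul_diagonal]
        simp

theorem cfc_eq_unitaryDiag {A : Matrix (Fin n) (Fin n) ℂ} (hA : A.IsHermitian) (f : ℝ → ℝ) :
    cfc f A = unitaryDiag hA.eigenvectorUnitary (fun i => f (hA.eigenvalues i)) := by
  rw [hA.cfc_eq, Matrix.IsHermitian.cfc, Unitary.conjStarAlgAut_apply]
  rfl

theorem eq_unitaryDiag {A : Matrix (Fin n) (Fin n) ℂ} (hA : A.IsHermitian) :
    A = unitaryDiag hA.eigenvectorUnitary hA.eigenvalues := by
  conv_lhs => rw [hA.spectral_theorem, Unitary.conjStarAlgAut_apply]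
  rfl

theorem rpow_eq_unitaryDiag {A : Matrix (Fin n) (Fin n) ℂ} (hA : A.PosSemidef) (r : ℝ) :
    A ^ r = unitaryDiag hA.1.eigenvectorUnitary (fun i => hA.1.eigenvalues i ^ r) := by
  rw [CFC.rpow_eq_cfc_real hA.nonneg, cfc_eq_unitaryDiag hA.1]

/-- Since 0 ^ r = 0 for r ≠ 0, negative powers are pseudo-inverse powers. The exponent law therefore
survives on the kernel except when the exponents cancel. -/
theorem rpow_mul_rpow {A : Matrix (Fin n) (Fin n) ℂ} (hA : A.PosSemidef) {r s : ℝ}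
    (h : r + s ≠ 0) : A ^ r * A ^ s = A ^ (r + s) := by
  simp only [rpow_eq_unitaryDiag hA, unitaryDiag_mul,
    Real.rpow_add' (hA.eigenvalues_nonneg _) h]

theorem rpow_posSemidef (A : Matrix (Fin n) (Fin n) ℂ) (r : ℝ) : (A ^ r).PosSemidef :=
  Matrix.nonneg_iff_posSemidef.1 CFC.rpow_nonneg

theorem rpow_conjTranspose (A : Matrix (Fin n) (Fin n) ℂ) (r : ℝ) : (A ^ r)ᴴ = A ^ r :=
  (rpow_posSemidef A r).1

/-- Conjugation by pseudo-inverse powers contracts to at most the identity. -/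
theorem rpow_neg_mul_rpow_mul_rpow_neg_le {A : Matrix (Fin n) (Fin n) ℂ} (hA : A.PosSemidef)
    (r : ℝ) : A ^ (-r) * A ^ (2 * r) * A ^ (-r) ≤ 1 := by
  have h1 : (1 : Matrix (Fin n) (Fin n) ℂ)
      = unitaryDiag hA.1.eigenvectorUnitary (fun _ => 1) := by
    simp [unitaryDiag, unitary_mul_conjTranspose_self]
  rw [Matrix.le_iff]
  simp only [rpow_eq_unitaryDiag hA, unitaryDiag_mul]
  rw [h1, unitaryDiag, unitaryDiag, ← sub_mul, ← mul_sub, Matrix.diagonal_sub]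
  refine Matrix.PosSemidef.mul_mul_conjTranspose_same (Matrix.PosSemidef.diagonal fun i => ?_) _
  have h0 := hA.eigenvalues_nonneg i
  rw [Pi.zero_apply, ← Complex.ofReal_sub, Complex.zero_le_real, sub_nonneg]
  rcases h0.eq_or_lt with h | h
  -- On the kernel the product is 1 if r = 0 and 0 otherwise, so it is at most 1 in both cases.
  · rw [← h]
    by_cases hr : r = 0
    · simp [hr]
    · simp [Real.zero_rpow (neg_ne_zero.2 hr)]
  · rw [← Real.rpow_add h, ← Real.rpow_add h]
    ring_nf
    simp

theorem conj_le_conj {A B : Matrix (Fin n) (Fin n) ℂ} (h : A ≤ B) (K : Matrix (Fin n) (Fin n) ℂ) :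
    K * A * Kᴴ ≤ K * B * Kᴴ := by
  rw [Matrix.le_iff, ← sub_mul, ← mul_sub]
  exact (Matrix.le_iff.1 h).mul_mul_conjTranspose_same K

/-- The two Hermitian products share a characteristic polynomial, hence their eigenvalues with
multiplicity; matching eigenbases gives the unitary. -/
theorem exists_unitary_conjTranspose_mul_self (K : Matrix (Fin n) (Fin n) ℂ) :
    ∃ U : Matrix.unitaryGroup (Fin n) ℂ,
      Kᴴ * K = (U : Matrix (Fin n) (Fin n) ℂ) * (K * Kᴴ) * (U : Matrix (Fin n) (Fin n) ℂ)ᴴ := by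
  have h1 : (Kᴴ * K).IsHermitian := Matrix.isHermitian_conjTranspose_mul_self K
  have h2 : (K * Kᴴ).IsHermitian := Matrix.isHermitian_mul_conjTranspose_self K
  have h : h1.eigenvalues = h2.eigenvalues :=
    (h1.eigenvalues_eq_eigenvalues_iff h2).2 (Matrix.charpoly_mul_comm _ _)
  refine ⟨h1.eigenvectorUnitary * h2.eigenvectorUnitary⁻¹, ?_⟩
  have hi : ((h2.eigenvectorUnitary⁻¹ : Matrix.unitaryGroup (Fin n) ℂ) :
      Matrix (Fin n) (Fin n) ℂ) = (h2.eigenvectorUnitary : Matrix (Fin n) (Fin n) ℂ)ᴴ := rfl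
  have e1 := eq_unitaryDiag h1
  have e2 := eq_unitaryDiag h2
  rw [Submonoid.coe_mul, hi, Matrix.conjTranspose_mul, Matrix.conjTranspose_conjTranspose]
  unfold unitaryDiag at e1 e2
  rw [h] at e1
  set V := (h2.eigenvectorUnitary : Matrix (Fin n) (Fin n) ℂ)
  set W := (h1.eigenvectorUnitary : Matrix (Fin n) (Fin n) ℂ)
  have hVV : Vᴴ * V = 1 := unitary_conjTranspose_mul_self _
  have key : W * Vᴴ * (V * Matrix.diagonal (fun i => (h2.eigenvalues i : ℂ)) * Vᴴ) * (V * Wᴴ)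
      = Kᴴ * K := by
    calc _ = W * (Vᴴ * V) * Matrix.diagonal (fun i => (h2.eigenvalues i : ℂ)) * (Vᴴ * V) * Wᴴ := by
          simp only [mul_assoc]
      _ = _ := by rw [hVV, mul_one, mul_one]; exact e1.symm
  exact key.symm.trans (congrArg (fun M => W * Vᴴ * M * (V * Wᴴ)) e2.symm)

/-! ### Quadratic forms and Jensen's inequality -/

/-- The value at `x` of the quadratic form of `A`. -/
noncomputable def quadForm (A : Matrix (Fin n) (Fin n) ℂ) (x : Fin n → ℂ) : ℝ :=
  (star x ⬝ᵥ (A *ᵥ x)).re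

theorem quadForm_add (A B : Matrix (Fin n) (Fin n) ℂ) (x : Fin n → ℂ) :
    quadForm (A + B) x = quadForm A x + quadForm B x := by
  simp [quadForm, Matrix.add_mulVec]

theorem quadForm_smul (c : ℝ) (A : Matrix (Fin n) (Fin n) ℂ) (x : Fin n → ℂ) :
    quadForm (c • A) x = c * quadForm A x := by
  simp [quadForm, Matrix.smul_mulVec]

theorem quadForm_mono {A B : Matrix (Fin n) (Fin n) ℂ} (h : A ≤ B) (x : Fin n → ℂ) :
    quadForm A x ≤ quadForm B x := by
  have := (Matrix.le_iff.1 h).re_dotProduct_nonneg x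
  simpa [quadForm, Matrix.sub_mulVec] using this

theorem quadForm_nonneg {A : Matrix (Fin n) (Fin n) ℂ} (hA : A.PosSemidef) (x : Fin n → ℂ) :
    0 ≤ quadForm A x := hA.re_dotProduct_nonneg x

theorem quadForm_conj (K A : Matrix (Fin n) (Fin n) ℂ) (x : Fin n → ℂ) :
    quadForm (K * A * Kᴴ) x = quadForm A (Kᴴ *ᵥ x) := by
  rw [quadForm, quadForm, Matrix.star_mulVec, Matrix.conjTranspose_conjTranspose,
    ← Matrix.mulVec_mulVec, ← Matrix.mulVec_mulVec, Matrix.dotProduct_mulVec]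

theorem quadForm_diagonal (d : Fin n → ℝ) (x : Fin n → ℂ) :
    quadForm (Matrix.diagonal (fun i => (d i : ℂ))) x = ∑ i, d i * ‖x i‖ ^ 2 := by
  simp only [quadForm, dotProduct, Matrix.mulVec_diagonal, Complex.re_sum, Pi.star_apply]
  refine Finset.sum_congr rfl fun i _ => ?_
  rw [← Complex.normSq_eq_norm_sq, Complex.normSq_apply]
  simp
  ring

theorem quadForm_unitaryDiag (U : Matrix.unitaryGroup (Fin n) ℂ) (d : Fin n → ℝ)
    (x : Fin n → ℂ) :
    quadForm (unitaryDiag U d) x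
      = ∑ i, d i * ‖((U : Matrix (Fin n) (Fin n) ℂ)ᴴ *ᵥ x) i‖ ^ 2 := by
  rw [unitaryDiag, quadForm_conj, quadForm_diagonal]

theorem quadForm_one (U : Matrix.unitaryGroup (Fin n) ℂ) (x : Fin n → ℂ) :
    quadForm 1 x = ∑ i, ‖((U : Matrix (Fin n) (Fin n) ℂ)ᴴ *ᵥ x) i‖ ^ 2 := by
  have h := quadForm_unitaryDiag U (fun _ => 1) x
  simpa [unitaryDiag, unitary_mul_conjTranspose_self] using h

/-- Jensen's inequality for the quadratic form of a power with exponent at least one. -/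
theorem quadForm_rpow_le {A : Matrix (Fin n) (Fin n) ℂ} (hA : A.PosSemidef) {q : ℝ} (hq : 1 ≤ q)
    {x : Fin n → ℂ} (hx : 0 < quadForm 1 x) :
    quadForm 1 x * (quadForm A x / quadForm 1 x) ^ q ≤ quadForm (A ^ q) x := by
  set y := (hA.1.eigenvectorUnitary : Matrix (Fin n) (Fin n) ℂ)ᴴ *ᵥ x with hy
  set a := quadForm 1 x with ha
  have ha' : a = ∑ i, ‖y i‖ ^ 2 := quadForm_one _ _
  have h := Real.rpow_arith_mean_le_arith_mean_rpow Finset.univ (fun i => ‖y i‖ ^ 2 / a)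
    hA.1.eigenvalues (fun i _ => by positivity)
    (by rw [← Finset.sum_div, ← ha', div_self hx.ne']) (fun i _ => hA.eigenvalues_nonneg i) hq
  have h1 : quadForm A x / a = ∑ i, ‖y i‖ ^ 2 / a * hA.1.eigenvalues i := by
    conv_lhs => rw [eq_unitaryDiag hA.1]
    rw [quadForm_unitaryDiag, Finset.sum_div]
    exact Finset.sum_congr rfl fun i _ => by ring
  have h2 : quadForm (A ^ q) x = a * ∑ i, ‖y i‖ ^ 2 / a * hA.1.eigenvalues i ^ q := by
    rw [rpow_eq_unitaryDiag hA, quadForm_unitaryDiag, Finset.mul_sum]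
    refine Finset.sum_congr rfl fun i _ => ?_
    field_simp
    rw [hy]
  rw [h1, h2]
  exact mul_le_mul_of_nonneg_left h hx.le

/-! ### Eigenvalue domination and unitary orbits -/

theorem exists_unitaryDiag_comp (V : Matrix.unitaryGroup (Fin n) ℂ) (d : Fin n → ℝ)
    (e : Fin n ≃ Fin n) :
    ∃ V' : Matrix.unitaryGroup (Fin n) ℂ, unitaryDiag V d = unitaryDiag V' (d ∘ e) := by
  set M := (V : Matrix (Fin n) (Fin n) ℂ).submatrix id e with hM
  have h : Mᴴ * M = 1 := by
    rw [hM, Matrix.conjTranspose_submatrix, ← Matrix.submatrix_mul _ _ _ _ _ Function.bijective_id,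
      unitary_conjTranspose_mul_self, Matrix.submatrix_one_equiv]
  refine ⟨⟨M, Matrix.mem_unitaryGroup_iff'.2 h⟩, ?_⟩
  have hd : Matrix.diagonal (fun i => ((d ∘ e) i : ℂ))
      = (Matrix.diagonal (fun i => (d i : ℂ))).submatrix e e := by
    rw [Matrix.submatrix_diagonal_equiv]
    rfl
  simp only [unitaryDiag]
  rw [hd, hM, Matrix.conjTranspose_submatrix, Matrix.submatrix_mul_equiv,
    Matrix.submatrix_mul_equiv, Matrix.submatrix_id_id]

/-- If the eigenvalues of `P` are dominated one by one by those of `Q`, then `P` lies below an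
element of the unitary orbit of `Q`. -/
theorem exists_unitary_le_of_eigenvalues_le (U V : Matrix.unitaryGroup (Fin n) ℂ)
    (d m : Fin n → ℝ) (e : Fin n ≃ Fin n) (h : ∀ i, d i ≤ m (e i)) :
    ∃ W : Matrix.unitaryGroup (Fin n) ℂ, unitaryDiag U d ≤
      (W : Matrix (Fin n) (Fin n) ℂ) * unitaryDiag V m * (W : Matrix (Fin n) (Fin n) ℂ)ᴴ := by
  obtain ⟨V', hV'⟩ := exists_unitaryDiag_comp V m e
  refine ⟨U * V'⁻¹, ?_⟩
  have hi : ((V'⁻¹ : Matrix.unitaryGroup (Fin n) ℂ) : Matrix (Fin n) (Fin n) ℂ)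
      = (V' : Matrix (Fin n) (Fin n) ℂ)ᴴ := rfl
  have key : ((U * V'⁻¹ : Matrix.unitaryGroup (Fin n) ℂ) : Matrix (Fin n) (Fin n) ℂ) *
      unitaryDiag V m * ((U * V'⁻¹ : Matrix.unitaryGroup (Fin n) ℂ) : Matrix (Fin n) (Fin n) ℂ)ᴴ
      = unitaryDiag U (m ∘ e) := by
    rw [hV', Submonoid.coe_mul, hi, Matrix.conjTranspose_mul, Matrix.conjTranspose_conjTranspose]
    unfold unitaryDiag
    calc _ = (U : Matrix (Fin n) (Fin n) ℂ) *
          ((V' : Matrix (Fin n) (Fin n) ℂ)ᴴ * (V' : Matrix (Fin n) (Fin n) ℂ)) *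
          Matrix.diagonal (fun i => ((m ∘ e) i : ℂ)) *
          ((V' : Matrix (Fin n) (Fin n) ℂ)ᴴ * (V' : Matrix (Fin n) (Fin n) ℂ)) *
          (U : Matrix (Fin n) (Fin n) ℂ)ᴴ := by simp only [mul_assoc]
      _ = _ := by rw [unitary_conjTranspose_mul_self, mul_one, mul_one]
  rw [key]
  unfold unitaryDiag
  refine conj_le_conj ?_ _
  rw [Matrix.le_iff, Matrix.diagonal_sub]
  refine Matrix.PosSemidef.diagonal fun i => ?_
  rw [Pi.zero_apply, ← Complex.ofReal_sub, Complex.zero_le_real, sub_nonneg]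
  exact h i

/-- A counting form of the Courant–Fischer principle. -/
theorem card_le_card_of_quadForm (U V : Matrix.unitaryGroup (Fin n) ℂ) (d m : Fin n → ℝ) (t : ℝ)
    (h : ∀ x : Fin n → ℂ, 0 < quadForm 1 x →
      (∀ j, d j < t → ((U : Matrix (Fin n) (Fin n) ℂ)ᴴ *ᵥ x) j = 0) →
      t * quadForm 1 x ≤ quadForm (unitaryDiag V m) x) :
    (Finset.univ.filter fun j => t ≤ d j).card ≤ (Finset.univ.filter fun j => t ≤ m j).card := by
  by_contra! hlt
  -- If the count failed, the equations "x is orthogonal to the columns of U with d j < t and to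
  -- those of V with t ≤ m j" would number fewer than n. A nonzero solution x makes the form of
  -- `unitaryDiag V m` strictly smaller than t times the squared norm of x.
  let M : Matrix ({j // d j < t} ⊕ {j // t ≤ m j}) (Fin n) ℂ :=
    Matrix.of (Sum.elim (fun j => (U : Matrix (Fin n) (Fin n) ℂ)ᴴ j.1)
      (fun j => (V : Matrix (Fin n) (Fin n) ℂ)ᴴ j.1))
  have hcard : Module.finrank ℂ (({j // d j < t} ⊕ {j // t ≤ m j}) → ℂ)
      < Module.finrank ℂ (Fin n → ℂ) := by
    rw [Module.finrank_fintype_fun_eq_card, Module.finrank_fintype_fun_eq_card, Fintype.card_sum,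
      Fintype.card_subtype, Fintype.card_subtype]
    have hs := Finset.card_filter_add_card_filter_not (s := (Finset.univ : Finset (Fin n)))
      (fun j => t ≤ d j)
    simp only [not_le, Finset.card_univ] at hs
    omega
  obtain ⟨x, hx, hx0⟩ := (Submodule.ne_bot_iff _).1
    (LinearMap.ker_ne_bot_of_finrank_lt (f := M.mulVecLin) hcard)
  rw [LinearMap.mem_ker, Matrix.mulVecLin_apply] at hx
  have hU : ∀ j, d j < t → ((U : Matrix (Fin n) (Fin n) ℂ)ᴴ *ᵥ x) j = 0 :=
    fun j hj => congrFun hx (Sum.inl ⟨j, hj⟩)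
  have hV : ∀ j, t ≤ m j → ((V : Matrix (Fin n) (Fin n) ℂ)ᴴ *ᵥ x) j = 0 :=
    fun j hj => congrFun hx (Sum.inr ⟨j, hj⟩)
  have hz : (V : Matrix (Fin n) (Fin n) ℂ)ᴴ *ᵥ x ≠ 0 := fun hz => hx0 <| by
    have := congrArg ((V : Matrix (Fin n) (Fin n) ℂ) *ᵥ ·) hz
    simpa [Matrix.mulVec_mulVec, unitary_mul_conjTranspose_self] using this
  obtain ⟨k, hk⟩ := Function.ne_iff.1 hz
  have hk' : 0 < ‖((V : Matrix (Fin n) (Fin n) ℂ)ᴴ *ᵥ x) k‖ ^ 2 :=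
    pow_pos (norm_pos_iff.2 hk) 2
  have hpos : 0 < quadForm 1 x := by
    rw [quadForm_one V]
    exact Finset.sum_pos' (fun i _ => by positivity) ⟨k, Finset.mem_univ _, hk'⟩
  have h1 := h x hpos hU
  rw [quadForm_one V, quadForm_unitaryDiag, Finset.mul_sum] at h1
  refine absurd h1 (not_le.2 (Finset.sum_lt_sum (fun j _ => ?_) ⟨k, Finset.mem_univ _, ?_⟩))
  · by_cases hj : t ≤ m j
    · simp [hV j hj]
    · exact mul_le_mul_of_nonneg_right (not_le.1 hj).le (by positivity)
  · exact mul_lt_mul_of_pos_right (not_le.1 fun hj => hk (hV k hj)) hk'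

/-- Hall's marriage theorem: i may be matched to j when d i ≤ m j. For a set of indices, the element
with the least d already has enough admissible partners. -/
theorem exists_equiv_le_of_card_le (d m : Fin n → ℝ)
    (h : ∀ k, (Finset.univ.filter fun j => d k ≤ d j).card
      ≤ (Finset.univ.filter fun j => d k ≤ m j).card) :
    ∃ e : Fin n ≃ Fin n, ∀ i, d i ≤ m (e i) := by
  obtain ⟨f, hf, hfm⟩ := (Finset.all_card_le_biUnion_card_iff_exists_injective
    (fun i => Finset.univ.filter fun j => d i ≤ m j)).1 fun s => by
      rcases s.eq_empty_or_nonempty with rfl | hs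
      · simp
      obtain ⟨k, hk, hmin⟩ := s.exists_min_image d hs
      calc s.card ≤ (Finset.univ.filter fun j => d k ≤ d j).card :=
            Finset.card_le_card fun j hj => by simpa using hmin j hj
        _ ≤ _ := h k
        _ ≤ _ := Finset.card_le_card
            (Finset.subset_biUnion_of_mem (fun i => Finset.univ.filter fun j => d i ≤ m j) hk)
  exact ⟨Equiv.ofBijective f (Finite.injective_iff_bijective.1 hf),
    fun i => by simpa using hfm i⟩

/-- If on each upper spectral subspace of `P` the quadratic form of `Q` is at least the smallest
eigenvalue of `P` there, then `P` lies below an element of the unitary orbit of `Q`. -/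
theorem exists_unitary_le_of_quadForm (U : Matrix.unitaryGroup (Fin n) ℂ) (d : Fin n → ℝ)
    {Q : Matrix (Fin n) (Fin n) ℂ} (hQ : Q.IsHermitian)
    (h : ∀ (k : Fin n) (x : Fin n → ℂ), 0 < quadForm 1 x →
      (∀ j, d j < d k → ((U : Matrix (Fin n) (Fin n) ℂ)ᴴ *ᵥ x) j = 0) →
      d k * quadForm 1 x ≤ quadForm Q x) :
    ∃ W : Matrix.unitaryGroup (Fin n) ℂ, unitaryDiag U d ≤
      (W : Matrix (Fin n) (Fin n) ℂ) * Q * (W : Matrix (Fin n) (Fin n) ℂ)ᴴ := by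
  have hQ' := eq_unitaryDiag hQ
  obtain ⟨e, he⟩ := exists_equiv_le_of_card_le d hQ.eigenvalues fun k =>
    card_le_card_of_quadForm U hQ.eigenvectorUnitary d hQ.eigenvalues (d k) fun x hx hU => by
      rw [← hQ']
      exact h k x hx hU
  obtain ⟨W, hW⟩ := exists_unitary_le_of_eigenvalues_le U hQ.eigenvectorUnitary d _ e he
  rw [← hQ'] at hW
  exact ⟨W, hW⟩

/-! ### Comparing R ^ q with R ^ (1/2) * S ^ (q-1) * R ^ (1/2) -/

theorem mul_quadForm_one_le (U : Matrix.unitaryGroup (Fin n) ℂ) (s : Fin n → ℝ) (k : Fin n)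
    (x : Fin n → ℂ)
    (hx : ∀ j, s j < s k → ((U : Matrix (Fin n) (Fin n) ℂ)ᴴ *ᵥ x) j = 0) :
    s k * quadForm 1 x ≤ quadForm (unitaryDiag U s) x := by
  rw [quadForm_one U, quadForm_unitaryDiag, Finset.mul_sum]
  refine Finset.sum_le_sum fun j _ => ?_
  by_cases hj : s j < s k
  · simp [hx j hj]
  · exact mul_le_mul_of_nonneg_right (not_lt.1 hj) (by positivity)

theorem mul_quadForm_le_quadForm_mul (U : Matrix.unitaryGroup (Fin n) ℂ) (s : Fin n → ℝ)
    (hs : ∀ j, 0 ≤ s j) (k : Fin n) (x : Fin n → ℂ)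
    (hx : ∀ j, s j < s k → ((U : Matrix (Fin n) (Fin n) ℂ)ᴴ *ᵥ x) j = 0) :
    s k * quadForm (unitaryDiag U s) x ≤ quadForm (unitaryDiag U s * unitaryDiag U s) x := by
  rw [unitaryDiag_mul, quadForm_unitaryDiag, quadForm_unitaryDiag, Finset.mul_sum]
  refine Finset.sum_le_sum fun j _ => ?_
  rw [← mul_assoc]
  by_cases hj : s j < s k
  · simp [hx j hj]
  · have := hs j
    have := not_lt.1 hj
    gcongr

/-- Let x lie in the spectral subspace of R for eigenvalues at least s k, and put w = R ^ (1/2) x.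
Then ‖w‖² = ⟨Rx, x⟩ ≥ s k ‖x‖² and ⟨Sw, w⟩ ≥ ⟨Rw, w⟩ = ⟨R²x, x⟩ ≥ s k ‖w‖². Jensen with exponent q -
1 ≥ 1 gives ⟨S ^ (q-1) w, w⟩ ≥ (s k) ^ q ‖x‖², which is the min-max criterion. -/
theorem exists_unitary_rpow_le_conj_rpow_of_two_le {R S : Matrix (Fin n) (Fin n) ℂ}
    (hR : R.PosSemidef) (hS : S.PosSemidef) (hRS : R ≤ S) {q : ℝ} (hq : 2 ≤ q) :
    ∃ W : Matrix.unitaryGroup (Fin n) ℂ, R ^ q ≤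
      (W : Matrix (Fin n) (Fin n) ℂ) * (R ^ (1 / 2 : ℝ) * S ^ (q - 1) * (R ^ (1 / 2 : ℝ))ᴴ) *
        (W : Matrix (Fin n) (Fin n) ℂ)ᴴ := by
  rw [rpow_eq_unitaryDiag hR q]
  have hhalf : R ^ (1 / 2 : ℝ) * R ^ (1 / 2 : ℝ) = R := by
    rw [rpow_mul_rpow hR (by norm_num), add_halves, CFC.rpow_one R hR.nonneg]
  refine exists_unitary_le_of_quadForm _ _
    ((rpow_posSemidef S _).mul_mul_conjTranspose_same _).1 fun k x hx hsupp => ?_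
  set s := hR.1.eigenvalues with hs
  have hs0 : ∀ j, 0 ≤ s j := hR.eigenvalues_nonneg
  have hsupp' : ∀ j, s j < s k →
      ((hR.1.eigenvectorUnitary : Matrix (Fin n) (Fin n) ℂ)ᴴ *ᵥ x) j = 0 :=
    fun j hj => hsupp j (Real.rpow_lt_rpow (hs0 j) hj (by linarith))
  have e := eq_unitaryDiag hR.1
  rw [quadForm_conj]
  -- Jensen needs w ≠ 0, which follows once s k > 0; for s k = 0 the bound is just positivity.
  rcases (hs0 k).eq_or_lt with h0 | h0
  · rw [← h0, Real.zero_rpow (by linarith), zero_mul]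
    exact quadForm_nonneg (rpow_posSemidef _ _) _
  set w := (R ^ (1 / 2 : ℝ))ᴴ *ᵥ x with hw
  have ha : quadForm 1 w = quadForm R x := by
    rw [hw, ← quadForm_conj, rpow_conjTranspose, mul_one, hhalf]
  have hRw : quadForm R w = quadForm (R * R) x := by
    rw [hw, ← quadForm_conj, rpow_conjTranspose]
    congr 1
    nth_rw 2 [← hhalf]
    rw [← mul_assoc, hhalf, mul_assoc, hhalf]
  have h1 : s k * quadForm 1 x ≤ quadForm 1 w := by
    rw [ha]
    conv_rhs => rw [e]
    exact mul_quadForm_one_le _ _ k x hsupp'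
  have h2 : s k * quadForm 1 w ≤ quadForm S w := by
    refine le_trans ?_ (quadForm_mono hRS w)
    rw [ha, hRw]
    have := mul_quadForm_le_quadForm_mul _ s hs0 k x hsupp'
    rwa [← e] at this
  have hpos : 0 < quadForm 1 w := lt_of_lt_of_le (mul_pos h0 hx) h1
  calc s k ^ q * quadForm 1 x = s k * quadForm 1 x * s k ^ (q - 1) := by
        rw [Real.rpow_sub_one h0.ne']
        field_simp
    _ ≤ quadForm 1 w * (quadForm S w / quadForm 1 w) ^ (q - 1) := by
        have : s k ≤ quadForm S w / quadForm 1 w := (le_div_iff₀ hpos).2 h2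
        have : (0 : ℝ) ≤ q - 1 := by linarith
        gcongr
    _ ≤ _ := quadForm_rpow_le hS (by linarith) hpos

theorem exists_unitary_rpow_le_conj_rpow {R S : Matrix (Fin n) (Fin n) ℂ}
    (hR : R.PosSemidef) (hS : S.PosSemidef) (hRS : R ≤ S) {q : ℝ} (hq : 1 ≤ q) :
    ∃ W : Matrix.unitaryGroup (Fin n) ℂ, R ^ q ≤
      (W : Matrix (Fin n) (Fin n) ℂ) * (R ^ (1 / 2 : ℝ) * S ^ (q - 1) * (R ^ (1 / 2 : ℝ))ᴴ) *
        (W : Matrix (Fin n) (Fin n) ℂ)ᴴ := by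
  rcases le_total 2 q with h2 | h2
  · exact exists_unitary_rpow_le_conj_rpow_of_two_le hR hS hRS h2
  -- For q ≤ 2 the exponent q - 1 lies in [0, 1], so Löwner–Heinz applies and no unitary is needed.
  refine ⟨1, ?_⟩
  have h : R ^ q = R ^ (1 / 2 : ℝ) * R ^ (q - 1) * (R ^ (1 / 2 : ℝ))ᴴ := by
    rw [rpow_conjTranspose, rpow_mul_rpow hR (by linarith), rpow_mul_rpow hR (by linarith)]
    congr 1
    ring
  rw [h]
  simpa using conj_le_conj (rpow_le_rpow ⟨by linarith, by linarith⟩ hRS) (R ^ (1 / 2 : ℝ))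

theorem rpow_half_mul_rpow_half {S : Matrix (Fin n) (Fin n) ℂ} (hS : S.PosSemidef) (r : ℝ) :
    S ^ (r / 2) * S ^ (r / 2) = S ^ r := by
  rcases eq_or_ne r 0 with rfl | h
  · simp [CFC.rpow_zero S hS.nonneg]
  · rw [rpow_mul_rpow hS (by simpa using h), add_halves]

/-- Exchange Kᴴ * K and K * Kᴴ for K = R ^ (1/2) * S ^ ((q-1)/2). -/
theorem exists_unitary_conj_rpow_half (R : Matrix (Fin n) (Fin n) ℂ)
    {S : Matrix (Fin n) (Fin n) ℂ} (hR : R.PosSemidef) (hS : S.PosSemidef) (q : ℝ) :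
    ∃ U : Matrix.unitaryGroup (Fin n) ℂ,
      S ^ ((q - 1) / 2) * R * S ^ ((q - 1) / 2) = (U : Matrix (Fin n) (Fin n) ℂ) *
        (R ^ (1 / 2 : ℝ) * S ^ (q - 1) * (R ^ (1 / 2 : ℝ))ᴴ) *
        (U : Matrix (Fin n) (Fin n) ℂ)ᴴ := by
  obtain ⟨U, hU⟩ := exists_unitary_conjTranspose_mul_self (R ^ (1 / 2 : ℝ) * S ^ ((q - 1) / 2))
  refine ⟨U, ?_⟩
  have hhalf : R ^ (1 / 2 : ℝ) * R ^ (1 / 2 : ℝ) = R := by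
    rw [rpow_half_mul_rpow_half hR, CFC.rpow_one R hR.nonneg]
  rw [Matrix.conjTranspose_mul] at hU
  simp only [rpow_conjTranspose] at hU ⊢
  rw [← rpow_half_mul_rpow_half hS (q - 1)]
  conv_lhs => rw [← hhalf]
  simpa only [mul_assoc] using hU

theorem conj_mul_unitary (W U : Matrix.unitaryGroup (Fin n) ℂ) (M : Matrix (Fin n) (Fin n) ℂ) :
    ((W * U : Matrix.unitaryGroup (Fin n) ℂ) : Matrix (Fin n) (Fin n) ℂ) * M *
      ((W * U : Matrix.unitaryGroup (Fin n) ℂ) : Matrix (Fin n) (Fin n) ℂ)ᴴ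
    = (W : Matrix (Fin n) (Fin n) ℂ) * ((U : Matrix (Fin n) (Fin n) ℂ) * M *
      (U : Matrix (Fin n) (Fin n) ℂ)ᴴ) * (W : Matrix (Fin n) (Fin n) ℂ)ᴴ := by
  rw [Submonoid.coe_mul, Matrix.conjTranspose_mul]
  simp only [mul_assoc]

theorem inv_conj_conj_unitary (W : Matrix.unitaryGroup (Fin n) ℂ)
    (M : Matrix (Fin n) (Fin n) ℂ) :
    ((W⁻¹ : Matrix.unitaryGroup (Fin n) ℂ) : Matrix (Fin n) (Fin n) ℂ) *
      ((W : Matrix (Fin n) (Fin n) ℂ) * M * (W : Matrix (Fin n) (Fin n) ℂ)ᴴ) *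
      ((W⁻¹ : Matrix.unitaryGroup (Fin n) ℂ) : Matrix (Fin n) (Fin n) ℂ)ᴴ = M := by
  rw [← conj_mul_unitary]
  simp

theorem exists_unitary_conj_rpow_le {R S : Matrix (Fin n) (Fin n) ℂ}
    (hR : R.PosSemidef) (hS : S.PosSemidef) (hRS : R ≤ S) {q : ℝ} (hq : 1 ≤ q) :
    ∃ U : Matrix.unitaryGroup (Fin n) ℂ,
      (U : Matrix (Fin n) (Fin n) ℂ) * R ^ q * (U : Matrix (Fin n) (Fin n) ℂ)ᴴ
        ≤ S ^ ((q - 1) / 2) * R * S ^ ((q - 1) / 2) := by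
  obtain ⟨U, hU⟩ := exists_unitary_conj_rpow_half R hR hS q
  obtain ⟨W, hW⟩ := exists_unitary_rpow_le_conj_rpow hR hS hRS hq
  refine ⟨U * W⁻¹, ?_⟩
  rw [hU, conj_mul_unitary]
  refine conj_le_conj ?_ _
  have h := conj_le_conj hW ((W⁻¹ : Matrix.unitaryGroup (Fin n) ℂ) : Matrix (Fin n) (Fin n) ℂ)
  rwa [inv_conj_conj_unitary] at h

theorem mul_conjTranspose_le_one {D : Matrix (Fin n) (Fin n) ℂ} (h : Dᴴ * D ≤ 1) :
    D * Dᴴ ≤ 1 := by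
  obtain ⟨U, hU⟩ := exists_unitary_conjTranspose_mul_self Dᴴ
  rw [Matrix.conjTranspose_conjTranspose] at hU
  rw [hU]
  refine (conj_le_conj h _).trans ?_
  rw [mul_one, unitary_mul_conjTranspose_self]

theorem exists_unitary_le_conj_rpow {R S : Matrix (Fin n) (Fin n) ℂ}
    (hR : R.PosSemidef) (hS : S.PosSemidef) (hRS : R ≤ S) {q : ℝ} (hq0 : 0 < q) (hq : q ≤ 1) :
    ∃ U : Matrix.unitaryGroup (Fin n) ℂ,
      S ^ ((q - 1) / 2) * R * S ^ ((q - 1) / 2)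
        ≤ (U : Matrix (Fin n) (Fin n) ℂ) * R ^ q * (U : Matrix (Fin n) (Fin n) ℂ)ᴴ := by
  obtain ⟨U, hU⟩ := exists_unitary_conj_rpow_half R hR hS q
  refine ⟨U, hU.trans_le (conj_le_conj ?_ _)⟩
  -- D is a contraction: R ^ (1-q) ≤ S ^ (1-q) by Löwner–Heinz, and conjugating by the
  -- pseudo-inverse power of S leaves at most 1. Then R ^ (1/2) * S ^ (q-1) * R ^ (1/2) = R ^ (q/2)
  -- * (D * Dᴴ) * R ^ (q/2) ≤ R ^ q.
  set D := R ^ ((1 - q) / 2) * S ^ ((q - 1) / 2) with hD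
  have hDD : Dᴴ * D ≤ 1 := by
    have h := conj_le_conj (rpow_le_rpow (r := 1 - q) ⟨by linarith, by linarith⟩ hRS)
      (S ^ ((q - 1) / 2))
    rw [rpow_conjTranspose] at h
    have h' := rpow_neg_mul_rpow_mul_rpow_neg_le hS ((1 - q) / 2)
    rw [show -((1 - q) / 2) = (q - 1) / 2 by ring, show 2 * ((1 - q) / 2) = 1 - q by ring] at h'
    refine le_trans (le_of_eq ?_) (h.trans h')
    rw [hD, Matrix.conjTranspose_mul, rpow_conjTranspose, rpow_conjTranspose,
      ← rpow_half_mul_rpow_half hR (1 - q)]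
    simp only [mul_assoc]
  have h := conj_le_conj (mul_conjTranspose_le_one hDD) (R ^ (q / 2))
  rw [mul_one, rpow_conjTranspose, rpow_half_mul_rpow_half hR] at h
  refine le_trans (le_of_eq ?_) h
  rw [hD, Matrix.conjTranspose_mul, rpow_conjTranspose, rpow_conjTranspose, rpow_conjTranspose,
    ← rpow_half_mul_rpow_half hS (q - 1)]
  have h1 : R ^ (1 / 2 : ℝ) = R ^ (q / 2) * R ^ ((1 - q) / 2) := by
    rw [rpow_mul_rpow hR (by ring_nf; norm_num)]
    congr 1
    ring
  have h2 : R ^ (1 / 2 : ℝ) = R ^ ((1 - q) / 2) * R ^ (q / 2) := by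
    rw [rpow_mul_rpow hR (by ring_nf; norm_num)]
    congr 1
    ring
  nth_rw 2 [h2]
  rw [h1]
  simp only [mul_assoc]

/-! ### Sums of powers against powers of sums -/

theorem sum_conj_rpow_half {ι : Type*} (s : Finset ι) (R : ι → Matrix (Fin n) (Fin n) ℂ)
    (hS : (∑ i ∈ s, R i).PosSemidef) {q : ℝ} (hq : 0 < q) :
    ∑ i ∈ s, (∑ i ∈ s, R i) ^ ((q - 1) / 2) * R i * (∑ i ∈ s, R i) ^ ((q - 1) / 2)
      = (∑ i ∈ s, R i) ^ q := by
  rw [← Finset.sum_mul, ← Finset.mul_sum]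
  set S := ∑ i ∈ s, R i
  nth_rw 2 [← CFC.rpow_one S hS.nonneg]
  rw [rpow_mul_rpow hS (by linarith), rpow_mul_rpow hS (by linarith)]
  congr 1
  ring

/-- Superadditivity up to unitary conjugation of powers with exponent at least one. -/
theorem exists_unitary_sum_conj_rpow_le {ι : Type*} (s : Finset ι)
    (R : ι → Matrix (Fin n) (Fin n) ℂ) (hR : ∀ i ∈ s, (R i).PosSemidef) {q : ℝ} (hq : 1 ≤ q) :
    ∃ U : ι → Matrix.unitaryGroup (Fin n) ℂ,
      ∑ i ∈ s, (U i : Matrix (Fin n) (Fin n) ℂ) * R i ^ q * (U i : Matrix (Fin n) (Fin n) ℂ)ᴴ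
        ≤ (∑ i ∈ s, R i) ^ q := by
  have hS : (∑ i ∈ s, R i).PosSemidef := Matrix.posSemidef_sum s hR
  have h : ∀ i, ∃ U : Matrix.unitaryGroup (Fin n) ℂ, i ∈ s →
      (U : Matrix (Fin n) (Fin n) ℂ) * R i ^ q * (U : Matrix (Fin n) (Fin n) ℂ)ᴴ
        ≤ (∑ i ∈ s, R i) ^ ((q - 1) / 2) * R i * (∑ i ∈ s, R i) ^ ((q - 1) / 2) := fun i => by
    by_cases hi : i ∈ s
    · obtain ⟨U, hU⟩ := exists_unitary_conj_rpow_le (hR i hi) hS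
        (Finset.single_le_sum (fun j hj => (hR j hj).nonneg) hi) hq
      exact ⟨U, fun _ => hU⟩
    · exact ⟨1, fun h => absurd h hi⟩
  choose U hU using h
  refine ⟨U, (Finset.sum_le_sum hU).trans_eq (sum_conj_rpow_half s R hS (by linarith))⟩

/-- Subadditivity up to unitary conjugation of powers with exponent at most one. -/
theorem exists_unitary_rpow_sum_le {ι : Type*} (s : Finset ι)
    (R : ι → Matrix (Fin n) (Fin n) ℂ) (hR : ∀ i ∈ s, (R i).PosSemidef) {q : ℝ} (hq0 : 0 < q)
    (hq : q ≤ 1) :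
    ∃ U : ι → Matrix.unitaryGroup (Fin n) ℂ,
      (∑ i ∈ s, R i) ^ q ≤
        ∑ i ∈ s, (U i : Matrix (Fin n) (Fin n) ℂ) * R i ^ q *
          (U i : Matrix (Fin n) (Fin n) ℂ)ᴴ := by
  have hS : (∑ i ∈ s, R i).PosSemidef := Matrix.posSemidef_sum s hR
  have h : ∀ i, ∃ U : Matrix.unitaryGroup (Fin n) ℂ, i ∈ s →
      (∑ i ∈ s, R i) ^ ((q - 1) / 2) * R i * (∑ i ∈ s, R i) ^ ((q - 1) / 2) ≤
      (U : Matrix (Fin n) (Fin n) ℂ) * R i ^ q * (U : Matrix (Fin n) (Fin n) ℂ)ᴴ := fun i => by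
    by_cases hi : i ∈ s
    · obtain ⟨U, hU⟩ := exists_unitary_le_conj_rpow (hR i hi) hS
        (Finset.single_le_sum (fun j hj => (hR j hj).nonneg) hi) hq0 hq
      exact ⟨U, fun _ => hU⟩
    · exact ⟨1, fun h => absurd h hi⟩
  choose U hU using h
  refine ⟨U, (sum_conj_rpow_half s R hS hq0).symm.trans_le (Finset.sum_le_sum hU)⟩

theorem smul_le_smul {A B : Matrix (Fin n) (Fin n) ℂ} (h : A ≤ B) {c : ℝ} (hc : 0 ≤ c) :
    c • A ≤ c • B := by
  rw [Matrix.le_iff, ← smul_sub]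
  exact (Matrix.le_iff.1 h).smul hc

theorem smul_rpow {A : Matrix (Fin n) (Fin n) ℂ} (hA : A.PosSemidef) {c : ℝ} (hc : 0 ≤ c)
    (r : ℝ) : (c • A) ^ r = c ^ r • A ^ r := by
  have hcA : (c • A).PosSemidef := hA.smul hc
  rw [CFC.rpow_eq_cfc_real hcA.nonneg, ← cfc_comp_smul c (· ^ r) A
    ((Matrix.finite_real_spectrum.image _).continuousOn _), cfc_eq_unitaryDiag hA.1,
    rpow_eq_unitaryDiag hA]
  simp only [smul_eq_mul, Real.mul_rpow hc (hA.eigenvalues_nonneg _)]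
  unfold unitaryDiag
  rw [← smul_mul_assoc, ← mul_smul_comm, ← Matrix.diagonal_smul]
  congr
  ext
  simp

theorem quadForm_sum {ι : Type*} (s : Finset ι) (R : ι → Matrix (Fin n) (Fin n) ℂ)
    (x : Fin n → ℂ) : quadForm (∑ i ∈ s, R i) x = ∑ i ∈ s, quadForm (R i) x := by
  classical
  induction s using Finset.induction_on with
  | empty => simp [quadForm]
  | insert a s ha ih => rw [Finset.sum_insert ha, Finset.sum_insert ha, quadForm_add, ih]

/-- Convexity up to unitary conjugation of powers with exponent at least one. -/
theorem exists_unitary_rpow_sum_le_conj {ι : Type*} (s : Finset ι)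
    (T : ι → Matrix (Fin n) (Fin n) ℂ) (hT : ∀ i ∈ s, (T i).PosSemidef) {q : ℝ} (hq : 1 ≤ q) :
    ∃ W : Matrix.unitaryGroup (Fin n) ℂ, (∑ i ∈ s, T i) ^ q ≤
      (W : Matrix (Fin n) (Fin n) ℂ) * ((s.card : ℝ) ^ (q - 1) • ∑ i ∈ s, T i ^ q) *
        (W : Matrix (Fin n) (Fin n) ℂ)ᴴ := by
  have hS : (∑ i ∈ s, T i).PosSemidef := Matrix.posSemidef_sum s hT
  set S := ∑ i ∈ s, T i with hSdef
  rw [rpow_eq_unitaryDiag hS]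
  refine exists_unitary_le_of_quadForm _ _ ?_ fun k x hx hsupp => ?_
  · exact ((Matrix.posSemidef_sum s fun i _ => rpow_posSemidef (T i) q).smul
      (by positivity : (0 : ℝ) ≤ (s.card : ℝ) ^ (q - 1))).1
  have hs0 := hS.eigenvalues_nonneg
  have h1 : hS.1.eigenvalues k * quadForm 1 x ≤ quadForm S x := by
    conv_rhs => rw [eq_unitaryDiag hS.1]
    exact mul_quadForm_one_le _ _ k x
      fun j hj => hsupp j (Real.rpow_lt_rpow (hs0 j) hj (by linarith))
  rw [quadForm_smul, quadForm_sum]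
  have h0 : 0 ≤ hS.1.eigenvalues k := hs0 k
  have hb : ∀ i ∈ s, 0 ≤ quadForm (T i) x / quadForm 1 x :=
    fun i hi => div_nonneg (quadForm_nonneg (hT i hi) x) hx.le
  -- On an upper spectral subspace of the sum, the scalar power-mean inequality is applied to the
  -- normalized forms of the T i; Jensen then moves the power inside each form.
  calc hS.1.eigenvalues k ^ q * quadForm 1 x
      ≤ (∑ i ∈ s, quadForm (T i) x / quadForm 1 x) ^ q * quadForm 1 x := by
        rw [← Finset.sum_div, ← quadForm_sum]
        have := (le_div_iff₀ hx).2 h1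
        gcongr
    _ ≤ ((s.card : ℝ) ^ (q - 1) * ∑ i ∈ s, (quadForm (T i) x / quadForm 1 x) ^ q)
          * quadForm 1 x := by
        gcongr
        exact Real.rpow_sum_le_const_mul_sum_rpow_of_nonneg s hq hb
    _ = (s.card : ℝ) ^ (q - 1) *
          ∑ i ∈ s, quadForm 1 x * (quadForm (T i) x / quadForm 1 x) ^ q := by
        rw [← Finset.mul_sum]
        ring
    _ ≤ _ := by
        gcongr with i hi
        exact quadForm_rpow_le (hT i hi) hq hx

/-- Operator concavity with equal weights 1 / |s|, the weights then being cleared by homogeneity. -/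
theorem sum_rpow_le_rpow_sum {ι : Type*} (s : Finset ι) (hs : s.Nonempty)
    (T : ι → Matrix (Fin n) (Fin n) ℂ) (hT : ∀ i ∈ s, (T i).PosSemidef) {q : ℝ} (hq0 : 0 ≤ q)
    (hq : q ≤ 1) :
    (s.card : ℝ) ^ (q - 1) • ∑ i ∈ s, T i ^ q ≤ (∑ i ∈ s, T i) ^ q := by
  have hc : (0 : ℝ) < s.card := by exact_mod_cast hs.card_pos
  have hc' : (s.card : ℝ) ≠ 0 := hc.ne'
  have h := (concaveOn_rpow (n := n) ⟨hq0, hq⟩).le_map_sum (t := s)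
    (w := fun _ => (s.card : ℝ)⁻¹) (p := T) (fun i _ => by positivity)
    (by simp [hc']) (fun i hi => (hT i hi).nonneg)
  rw [← Finset.smul_sum, ← Finset.smul_sum] at h
  simp only [smul_rpow (Matrix.posSemidef_sum s hT) (inv_nonneg.2 hc.le)] at h
  have h' := smul_le_smul h (by positivity : (0 : ℝ) ≤ (s.card : ℝ) ^ q)
  rwa [smul_smul, smul_smul, Real.inv_rpow hc.le, mul_inv_cancel₀ (by positivity), one_smul,
    ← div_eq_mul_inv, ← Real.rpow_sub_one hc'] at h'

/-! ### Powers of the absolute value -/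

theorem absPow_eq_rpow_half (X : Matrix (Fin n) (Fin n) ℂ) {p : ℝ} (hp : 0 ≤ p) :
    absPow X p = (Xᴴ * X) ^ (p / 2) := by
  rw [absPow, CFC.abs, CFC.sqrt_eq_rpow,
    CFC.rpow_rpow_of_exponent_nonneg _ _ _ (by norm_num) hp (star_mul_self_nonneg X)]
  congr 1
  ring

theorem absPow_neg (X : Matrix (Fin n) (Fin n) ℂ) (p : ℝ) : absPow (-X) p = absPow X p := by
  rw [absPow, CFC.abs_neg, absPow]

theorem absPow_zero {p : ℝ} (hp : 0 < p) : absPow (0 : Matrix (Fin n) (Fin n) ℂ) p = 0 := by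
  rw [absPow, CFC.abs_zero]
  exact CFC.zero_rpow hp.ne'

theorem absPow_add_self (X : Matrix (Fin n) (Fin n) ℂ) {p : ℝ} (hp : 0 < p) :
    absPow (X + X) p = (2 : ℝ) ^ p • absPow X p := by
  have h : (X + X)ᴴ * (X + X) = (4 : ℝ) • (Xᴴ * X) := by
    rw [← two_smul ℝ X, Matrix.conjTranspose_smul, smul_mul_smul_comm]
    norm_num
  rw [absPow_eq_rpow_half _ hp.le, absPow_eq_rpow_half _ hp.le, h,
    smul_rpow (Matrix.posSemidef_conjTranspose_mul_self X) (by norm_num)]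
  congr 1
  rw [show (4 : ℝ) = 2 ^ (2 : ℝ) by norm_num, ← Real.rpow_mul (by norm_num)]
  congr 1
  ring

theorem absPow_ne_zero {X : Matrix (Fin n) (Fin n) ℂ} (hX : X ≠ 0) {p : ℝ} (hp : 0 < p) :
    absPow X p ≠ 0 := fun h => hX <| by
  rw [absPow_eq_rpow_half _ hp.le] at h
  have h' := congrArg (· ^ (p / 2)⁻¹) h
  rw [CFC.rpow_rpow_of_exponent_nonneg _ _ _ (by positivity) (by positivity)
    (Matrix.posSemidef_conjTranspose_mul_self X).nonneg, mul_inv_cancel₀ (by positivity),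
    CFC.rpow_one _ (Matrix.posSemidef_conjTranspose_mul_self X).nonneg] at h'
  exact Matrix.conjTranspose_mul_self_eq_zero.1 (h'.trans (CFC.zero_rpow (by positivity)))

theorem absPow_one (p : ℝ) : absPow (1 : Matrix (Fin n) (Fin n) ℂ) p = 1 := by
  rw [absPow, CFC.abs_one, CFC.one_rpow]

/-- The source of the constant: the card factor |s| ^ (q - 1) for the four summands of `eulerSq`,
with q = p / 2. -/
theorem two_rpow_sub_two (p : ℝ) : (2 : ℝ) ^ (p - 2) = 4 ^ (p / 2 - 1) := by
  rw [show (4 : ℝ) = 2 ^ (2 : ℝ) by norm_num, ← Real.rpow_mul (by norm_num)]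
  congr 1
  ring

theorem two_rpow_sub_two_mul_four (p : ℝ) : (2 : ℝ) ^ (p - 2) * 4 = 2 ^ p := by
  rw [Real.rpow_sub (by norm_num)]
  norm_num

/-! ### Euler's identity and the orbit inequalities -/

/-- The family `|A+B|², |B+C|², |C+A|²`. -/
def pairSq (A B C : Matrix (Fin n) (Fin n) ℂ) : Fin 3 → Matrix (Fin n) (Fin n) ℂ :=
  ![(A + B)ᴴ * (A + B), (B + C)ᴴ * (B + C), (C + A)ᴴ * (C + A)]

/-- The family `|A+B+C|², |A|², |B|², |C|²`. -/
def eulerSq (A B C : Matrix (Fin n) (Fin n) ℂ) : Fin 4 → Matrix (Fin n) (Fin n) ℂ :=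
  ![(A + B + C)ᴴ * (A + B + C), Aᴴ * A, Bᴴ * B, Cᴴ * C]

theorem pairSq_posSemidef (A B C : Matrix (Fin n) (Fin n) ℂ) (i : Fin 3) :
    (pairSq A B C i).PosSemidef := by
  fin_cases i <;> exact Matrix.posSemidef_conjTranspose_mul_self _

theorem eulerSq_posSemidef (A B C : Matrix (Fin n) (Fin n) ℂ) (i : Fin 4) :
    (eulerSq A B C i).PosSemidef := by
  fin_cases i <;> exact Matrix.posSemidef_conjTranspose_mul_self _

/-- Euler's identity, the case `p = 2`. -/
theorem sum_pairSq (A B C : Matrix (Fin n) (Fin n) ℂ) :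
    ∑ i, pairSq A B C i = ∑ i, eulerSq A B C i := by
  simp only [Fin.sum_univ_three, Fin.sum_univ_four, pairSq, eulerSq, Matrix.cons_val,
    Matrix.conjTranspose_add]
  noncomm_ring

theorem sum_eulerSq_rpow (A B C : Matrix (Fin n) (Fin n) ℂ) {p : ℝ} (hp : 0 ≤ p) :
    ∑ i, eulerSq A B C i ^ (p / 2) = eulerSum p A B C := by
  simp only [Fin.sum_univ_four, eulerSq, eulerSum, Matrix.cons_val, absPow_eq_rpow_half _ hp]

theorem sum_conj_pairSq_rpow (A B C : Matrix (Fin n) (Fin n) ℂ) {p : ℝ} (hp : 0 ≤ p)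
    (U : Fin 3 → Matrix.unitaryGroup (Fin n) ℂ) :
    ∑ i, (U i : Matrix (Fin n) (Fin n) ℂ) * pairSq A B C i ^ (p / 2) *
      (U i : Matrix (Fin n) (Fin n) ℂ)ᴴ = pairOrbitSum p A B C (U 0) (U 1) (U 2) := by
  simp only [Fin.sum_univ_three, pairSq, pairOrbitSum, Matrix.cons_val, absPow_eq_rpow_half _ hp]

theorem exists_pairOrbitSum_le (A B C : Matrix (Fin n) (Fin n) ℂ) {p : ℝ} (hp : 2 ≤ p) :
    ∃ U₁ U₂ U₃ : Matrix.unitaryGroup (Fin n) ℂ,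
      pairOrbitSum p A B C U₁ U₂ U₃ ≤ (2 : ℝ) ^ (p - 2) • eulerSum p A B C := by
  obtain ⟨U, hU⟩ := exists_unitary_sum_conj_rpow_le Finset.univ (pairSq A B C)
    (fun i _ => pairSq_posSemidef A B C i) (q := p / 2) (by linarith)
  obtain ⟨W, hW⟩ := exists_unitary_rpow_sum_le_conj Finset.univ (eulerSq A B C)
    (fun i _ => eulerSq_posSemidef A B C i) (q := p / 2) (by linarith)
  rw [sum_pairSq] at hU
  -- Conjugating by W⁻¹ frees the upper bound of its unitary, which is absorbed into the three on
  -- the left.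
  have h := conj_le_conj (hU.trans hW)
    ((W⁻¹ : Matrix.unitaryGroup (Fin n) ℂ) : Matrix (Fin n) (Fin n) ℂ)
  rw [inv_conj_conj_unitary, Finset.mul_sum, Finset.sum_mul,
    sum_eulerSq_rpow A B C (by linarith)] at h
  simp only [← conj_mul_unitary] at h
  rw [sum_conj_pairSq_rpow A B C (by linarith) (fun i => W⁻¹ * U i)] at h
  refine ⟨_, _, _, h.trans_eq ?_⟩
  rw [two_rpow_sub_two]
  simp

theorem exists_le_pairOrbitSum (A B C : Matrix (Fin n) (Fin n) ℂ) {p : ℝ} (hp0 : 0 < p)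
    (hp : p ≤ 2) :
    ∃ U₁ U₂ U₃ : Matrix.unitaryGroup (Fin n) ℂ,
      (2 : ℝ) ^ (p - 2) • eulerSum p A B C ≤ pairOrbitSum p A B C U₁ U₂ U₃ := by
  obtain ⟨U, hU⟩ := exists_unitary_rpow_sum_le Finset.univ (pairSq A B C)
    (fun i _ => pairSq_posSemidef A B C i) (q := p / 2) (by linarith) (by linarith)
  have h := sum_rpow_le_rpow_sum Finset.univ Finset.univ_nonempty (eulerSq A B C)
    (fun i _ => eulerSq_posSemidef A B C i) (q := p / 2) (by linarith) (by linarith)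
  rw [sum_pairSq, sum_conj_pairSq_rpow A B C hp0.le] at hU
  rw [sum_eulerSq_rpow A B C hp0.le] at h
  refine ⟨_, _, _, le_trans (le_of_eq ?_) (h.trans hU)⟩
  rw [two_rpow_sub_two]
  simp

/-! ### Equality case and optimality -/

theorem eulerSum_self_self_neg (A : Matrix (Fin n) (Fin n) ℂ) (p : ℝ) :
    eulerSum p A A (-A) = (4 : ℝ) • absPow A p := by
  rw [eulerSum, add_neg_cancel_right, absPow_neg]
  module

theorem rpow_smul_eulerSum_self_self_neg (A : Matrix (Fin n) (Fin n) ℂ) (p : ℝ) :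
    (2 : ℝ) ^ (p - 2) • eulerSum p A A (-A) = (2 : ℝ) ^ p • absPow A p := by
  rw [eulerSum_self_self_neg, smul_smul, two_rpow_sub_two_mul_four]

/-- Two of the three pair sums vanish, and p > 0 makes their powers vanish too. -/
theorem pairOrbitSum_self_self_neg (A : Matrix (Fin n) (Fin n) ℂ) {p : ℝ} (hp : 0 < p)
    (U₁ U₂ U₃ : Matrix.unitaryGroup (Fin n) ℂ) :
    pairOrbitSum p A A (-A) U₁ U₂ U₃ = (U₁ : Matrix (Fin n) (Fin n) ℂ) *
      ((2 : ℝ) ^ p • absPow A p) * (U₁ : Matrix (Fin n) (Fin n) ℂ)ᴴ := by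
  rw [pairOrbitSum, add_neg_cancel, neg_add_cancel, absPow_zero hp, absPow_add_self A hp]
  simp

theorem pairOrbitSum_one_one_neg_one {p : ℝ} (hp : 0 < p)
    (U₁ U₂ U₃ : Matrix.unitaryGroup (Fin n) ℂ) :
    pairOrbitSum p 1 1 (-1) U₁ U₂ U₃ = (2 : ℝ) ^ p • (1 : Matrix (Fin n) (Fin n) ℂ) := by
  rw [pairOrbitSum_self_self_neg 1 hp, absPow_one, mul_smul_comm, mul_one, smul_mul_assoc,
    unitary_mul_conjTranspose_self]

theorem le_of_smul_one_le_smul_one (hn : 0 < n) {a b : ℝ}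
    (h : a • (1 : Matrix (Fin n) (Fin n) ℂ) ≤ b • 1) : a ≤ b := by
  have h' := (Matrix.le_iff.1 h).diag_nonneg (i := ⟨0, hn⟩)
  rw [← sub_smul] at h'
  simpa [← Complex.ofReal_sub] using h'

/-- A positive semidefinite matrix of trace zero is zero. As unitary conjugation preserves the
trace, a matrix comparable with its own conjugate equals it. -/
theorem eq_of_le_of_trace_eq {A B : Matrix (Fin n) (Fin n) ℂ} (h : A ≤ B)
    (ht : A.trace = B.trace) : A = B := by
  have := (Matrix.le_iff.1 h).trace_eq_zero_iff.1 (by rw [Matrix.trace_sub, ht, sub_self])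
  exact (sub_eq_zero.1 this).symm

theorem trace_conj_unitary (U : Matrix.unitaryGroup (Fin n) ℂ) (M : Matrix (Fin n) (Fin n) ℂ) :
    ((U : Matrix (Fin n) (Fin n) ℂ) * M * (U : Matrix (Fin n) (Fin n) ℂ)ᴴ).trace = M.trace := by
  rw [Matrix.trace_mul_comm, ← mul_assoc, unitary_conjTranspose_mul_self, one_mul]

end MatrixOrbit

/-- Here `≤` between matrices is the Loewner order: `X ≤ Y` means that `Y - X` is positive
semidefinite. -/
theorem theorem1p19 (n : ℕ) :
    -- the orbit inequality for `p ≥ 2`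
    (∀ (p : ℝ) (A B C : Matrix (Fin n) (Fin n) ℂ), 2 ≤ p →
      ∃ U₁ U₂ U₃ : Matrix.unitaryGroup (Fin n) ℂ,
        pairOrbitSum p A B C U₁ U₂ U₃ ≤ (2 : ℝ) ^ (p - 2) • eulerSum p A B C) ∧
    -- the reversed orbit inequality for `0 < p ≤ 2`
    (∀ (p : ℝ) (A B C : Matrix (Fin n) (Fin n) ℂ), 0 < p → p ≤ 2 →
      ∃ U₁ U₂ U₃ : Matrix.unitaryGroup (Fin n) ℂ,
        (2 : ℝ) ^ (p - 2) • eulerSum p A B C ≤ pairOrbitSum p A B C U₁ U₂ U₃) ∧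
    -- no smaller constant works for `p ≥ 2`
    (0 < n → ∀ p c : ℝ, 2 ≤ p →
      (∀ A B C : Matrix (Fin n) (Fin n) ℂ, ∃ U₁ U₂ U₃ : Matrix.unitaryGroup (Fin n) ℂ,
        pairOrbitSum p A B C U₁ U₂ U₃ ≤ c • eulerSum p A B C) →
      (2 : ℝ) ^ (p - 2) ≤ c) ∧
    -- no larger constant works for `0 < p ≤ 2`
    (0 < n → ∀ p c : ℝ, 0 < p → p ≤ 2 →
      (∀ A B C : Matrix (Fin n) (Fin n) ℂ, ∃ U₁ U₂ U₃ : Matrix.unitaryGroup (Fin n) ℂ,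
        c • eulerSum p A B C ≤ pairOrbitSum p A B C U₁ U₂ U₃) →
      c ≤ (2 : ℝ) ^ (p - 2)) ∧
    -- for `A = B = -C ≠ 0` and every `p > 0` equality holds: it is attained, both sides are nonzero,
    -- and any unitaries for which one of the two inequalities holds give equality
    (∀ (p : ℝ) (A : Matrix (Fin n) (Fin n) ℂ), 0 < p → A ≠ 0 →
      (2 : ℝ) ^ (p - 2) • eulerSum p A A (-A) ≠ 0 ∧
      (∃ U₁ U₂ U₃ : Matrix.unitaryGroup (Fin n) ℂ,
        pairOrbitSum p A A (-A) U₁ U₂ U₃ = (2 : ℝ) ^ (p - 2) • eulerSum p A A (-A)) ∧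
      (∀ U₁ U₂ U₃ : Matrix.unitaryGroup (Fin n) ℂ,
        (pairOrbitSum p A A (-A) U₁ U₂ U₃ ≤ (2 : ℝ) ^ (p - 2) • eulerSum p A A (-A) ∨
          (2 : ℝ) ^ (p - 2) • eulerSum p A A (-A) ≤ pairOrbitSum p A A (-A) U₁ U₂ U₃) →
        pairOrbitSum p A A (-A) U₁ U₂ U₃ = (2 : ℝ) ^ (p - 2) • eulerSum p A A (-A))) := by
  refine ⟨fun p A B C hp => MatrixOrbit.exists_pairOrbitSum_le A B C hp,
    fun p A B C hp0 hp => MatrixOrbit.exists_le_pairOrbitSum A B C hp0 hp,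
    fun hn p c hp h => ?_, fun hn p c hp0 hp h => ?_, fun p A hp hA => ⟨?_, ⟨1, 1, 1, ?_⟩, ?_⟩⟩
  -- At the triple 1, 1, -1 both sides are scalar multiples of the identity, and the hypothesis
  -- becomes 2 ^ p ≤ 4 c.
  · obtain ⟨U₁, U₂, U₃, hU⟩ := h 1 1 (-1)
    rw [MatrixOrbit.pairOrbitSum_one_one_neg_one (by linarith),
      MatrixOrbit.eulerSum_self_self_neg, MatrixOrbit.absPow_one, smul_smul] at hU
    have h1 := MatrixOrbit.le_of_smul_one_le_smul_one hn hU
    rw [← MatrixOrbit.two_rpow_sub_two_mul_four] at h1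
    linarith
  · obtain ⟨U₁, U₂, U₃, hU⟩ := h 1 1 (-1)
    rw [MatrixOrbit.pairOrbitSum_one_one_neg_one hp0,
      MatrixOrbit.eulerSum_self_self_neg, MatrixOrbit.absPow_one, smul_smul] at hU
    have h1 := MatrixOrbit.le_of_smul_one_le_smul_one hn hU
    rw [← MatrixOrbit.two_rpow_sub_two_mul_four] at h1
    linarith
  · rw [MatrixOrbit.rpow_smul_eulerSum_self_self_neg]
    exact smul_ne_zero (by positivity) (MatrixOrbit.absPow_ne_zero hA hp)
  · rw [MatrixOrbit.rpow_smul_eulerSum_self_self_neg, MatrixOrbit.pairOrbitSum_self_self_neg A hp]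
    simp
  · intro U₁ U₂ U₃ h
    rw [MatrixOrbit.rpow_smul_eulerSum_self_self_neg,
      MatrixOrbit.pairOrbitSum_self_self_neg A hp] at h ⊢
    have ht := MatrixOrbit.trace_conj_unitary U₁ ((2 : ℝ) ^ p • absPow A p)
    exact h.elim (fun h => MatrixOrbit.eq_of_le_of_trace_eq h ht)
      (fun h => (MatrixOrbit.eq_of_le_of_trace_eq h ht.symm).symm)
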